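/- Let $\mathbb{G}$ be a Carnot group of topological dimension $n$ with Lie algebra $\mathfrak g=V_1\oplus\dots\oplus V_\kappa$ of left-invariant vector fields, where $[V_1,V_i]=V_{i+1}$ for $1\le i<\kappa$ and $[V_1,V_\kappa]=\{0\}$. Let $X_1,\dots,X_n$ be an adapted basis of $\mathfrak g$ (ordered layer by layer, with $X_1,\dots,X_{m_1}$ a basis of $V_1$), and identify $\mathbb{G}$ with $\mathbb{R}^n$ through the associated exponential coordinates, so that the identity is $0$, $X_i(0)=\mathrm e_i$, and the Haar measure is the Lebesgue measure $\mathcal L^n$. Let $\|\cdot\|_{\mathbb G}$ be the norm of the left-invariant Riemannian metric for which $X_1,\dots,X_n$ are orthonormal, let $H_x\mathbb{G}=\mathrm{span}\{X_1(x),\dots,X_{m_1}(x)\}$ be the horizontal space at $x$, and let $\mathsf d_{cc}(x,y)$ be the Carnot–Carathéodory distance, i.e. the infimum of $\int_0^1\|\dot\gamma(t)\|_{\mathbb G}\,dt$ over Lipschitz curves $\gamma:[0,1]\to\mathbb{G}$ from $x$ to $y$ with $\dot\gamma(t)\in H_{\gamma(t)}\mathbb{G}$ for a.e. $t$. Let $\mathcal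 P_2(\mathbb{G})$ be the set of Borel probability measures on $\mathbb{G}$ with $\int \mathsf d_{cc}(x,x_0)^2\,d\mu(x)<+\infty$ for some $x_0$, with the quadratic Wasserstein distance $$\mathsf W_{\mathbb G}(\mu,\nu)^2=\inf\Big\{\int \mathsf d_{cc}(x,y)^2\,d\pi(x,y):\ \pi \text{ a coupling of } \mu \text{ and } \nu\Big\}.$$ Let $\mathsf{Ent}(\mu)=\int\rho\log\rho\,d\mathcal L^n$ if $\mu=\rho\mathcal L^n\in\mathcal P_2(\mathbb G)$, and $\mathsf{Ent}(\mu)=+\infty$ otherwise. For $\mu\in\mathcal P_2(\mathbb G)$ with $\mathsf{Ent}(\mu)\in\mathbb R$ let $$|\mathrm D^-_{\mathbb G}\mathsf{Ent}|(\mu)=\limsup_{\nu\to\mu,\ \nu\ne\mu}\frac{[\mathsf{Ent}(\nu)-\mathsf{Ent}(\mu)]^-}{\mathsf W_{\mathbb G}(\nu,\mu)}$$ be the descending slope of $\mathsf{Ent}$ at $\mu$ in $(\mathcal P_2(\mathbb G),\mathsf W_{\mathbb G})$ (equal to $0$ if $\mu$ is isolated), and set $|\mathrm D^-_{\mathbb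 G}\mathsf{Ent}|(\mu)=+\infty$ if $\mathsf{Ent}(\mu)\notin\mathbb R$. **Statement.** Let $\mu=\rho\mathcal L^n\in\mathcal P_2(\mathbb G)$ satisfy $|\mathrm D^-_{\mathbb G}\mathsf{Ent}|(\mu)<+\infty$. Then $\rho\in W^{1,1}_{\mathbb G,\mathrm{loc}}(\mathbb G)$, that is, $\rho\in L^1_{\mathrm{loc}}$ and its distributional derivatives $X_i\rho$, $1\le i\le m_1$, belong to $L^1_{\mathrm{loc}}$. Moreover, there is a Borel vector field $w$ on $\mathbb G$ with $w(x)\in H_x\mathbb G$ for every $x$ such that $$\nabla_{\mathbb G}\rho:=\sum_{i=1}^{m_1}(X_i\rho)\,X_i=\rho\,w\quad\text{a.e.},\qquad \Big(\int_{\mathbb G}\|w\|_{\mathbb G}^2\,d\mu\Big)^{1/2}\le|\mathrm D^-_{\mathbb G}\mathsf{Ent}|(\mu).$$ -/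

import Mathlib

open MeasureTheory Set Filter
open scoped ContDiff

/-! ### Metric and measure notions (distances take values in `[0,∞]`) -/

/-- Descending slope `|D⁻f|(x) = limsup_{y → x} [f(y) - f(x)]⁻ / d(x,y)` of an extended-real
function on a space with distance `d`. It is `+∞` where `f` is not finite; at an isolated point
the supremum is over the empty set for small `r`, which gives `0`.
Note `[f(y) - f(x)]⁻ = [f(x) - f(y)]⁺`, and `EReal.toENNReal` is the positive part. -/
noncomputable def descendingSlope {X : Type*} (d : X → X → ENNReal) (f : X → EReal) (x : X) :
    ENNReal :=
  open Classical in
  if f x = ⊤ ∨ f x = ⊥ then ⊤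
  else ⨅ r : ENNReal, ⨅ _ : 0 < r, ⨆ y : X, ⨆ _ : y ≠ x ∧ d x y < r,
    (f x - f y).toENNReal / d x y

/-- The quadratic Wasserstein distance `W(μ,ν)` for the cost `d(x,y)²`. -/
noncomputable def wassersteinDist {X : Type*} [MeasurableSpace X] (d : X → X → ENNReal)
    (μ ν : Measure X) : ENNReal :=
  (⨅ π : Measure (X × X), ⨅ _ : π.map Prod.fst = μ ∧ π.map Prod.snd = ν,
    ∫⁻ p, d p.1 p.2 ^ 2 ∂π) ^ (1 / 2 : ℝ)

/-- The set `P₂(X)` of Borel probability measures with finite second moment. -/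
def WassersteinSpace {X : Type*} [MeasurableSpace X] (d : X → X → ENNReal) : Type _ :=
  {μ : Measure X // IsProbabilityMeasure μ ∧ ∃ x₀ : X, ∫⁻ x, d x x₀ ^ 2 ∂μ < ⊤}

/-- The relative entropy `∫ ρ log ρ dm` if `μ = ρ m`, and `+∞` otherwise. The integral is the
difference of the integrals of the positive and of the negative part of `ρ log ρ`. -/
noncomputable def relEntropy {X : Type*} [MeasurableSpace X] (m μ : Measure X) : EReal :=
  open Classical in
  if μ ≪ m then
    ((∫⁻ x, ENNReal.ofReal ((μ.rnDeriv m x).toReal * Real.log (μ.rnDeriv m x).toReal) ∂m :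
      ENNReal) : EReal) -
    ((∫⁻ x, ENNReal.ofReal (-((μ.rnDeriv m x).toReal * Real.log (μ.rnDeriv m x).toReal)) ∂m :
      ENNReal) : EReal)
  else ⊤

/-- The Euclidean divergence of a vector field on `ℝⁿ`. -/
noncomputable def euclideanDiv {n : ℕ}
    (V : EuclideanSpace ℝ (Fin n) → EuclideanSpace ℝ (Fin n)) (x : EuclideanSpace ℝ (Fin n)) : ℝ :=
  ∑ i, (fderiv ℝ V x (EuclideanSpace.single i 1)) i

/-! ### Carnot groups in exponential coordinates -/

/-- A Lie group structure on `ℝⁿ`, with identity `0`, for which the standard coordinates are the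
exponential coordinates with respect to the left-invariant frame `X₁, …, Xₙ` with `Xᵢ(0) = eᵢ`:
for every `x` the line `t ↦ t x` is a one-parameter subgroup, i.e. `exp (∑ xᵢ Xᵢ) = x`.
In particular `-x` is the inverse of `x`. -/
structure ExpLieGroup (n : ℕ) where
  /-- the group law -/
  mul : EuclideanSpace ℝ (Fin n) → EuclideanSpace ℝ (Fin n) → EuclideanSpace ℝ (Fin n)
  contDiff_mul : ContDiff ℝ ∞
    (fun p : EuclideanSpace ℝ (Fin n) × EuclideanSpace ℝ (Fin n) => mul p.1 p.2)
  mul_assoc : ∀ x y z, mul (mul x y) z = mul x (mul y z)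
  zero_mul : ∀ x, mul 0 x = x
  mul_zero : ∀ x, mul x 0 = x
  smul_mul_smul : ∀ (s t : ℝ) (x : EuclideanSpace ℝ (Fin n)), mul (s • x) (t • x) = (s + t) • x

namespace ExpLieGroup

variable {n : ℕ} (G : ExpLieGroup n)

/-- The left-invariant vector field `x ↦ dl_x u` with value `u` at the identity. -/
noncomputable def leftField (u x : EuclideanSpace ℝ (Fin n)) : EuclideanSpace ℝ (Fin n) :=
  fderiv ℝ (G.mul x) 0 u

/-- The left-invariant vector field `Xᵢ`, `Xᵢ(x) = dl_x eᵢ`. -/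
noncomputable def X (i : Fin n) (x : EuclideanSpace ℝ (Fin n)) : EuclideanSpace ℝ (Fin n) :=
  G.leftField (EuclideanSpace.single i 1) x

/-- The Lie bracket of the Lie algebra, read on the tangent space `ℝⁿ` at the identity. -/
noncomputable def bracket (u v : EuclideanSpace ℝ (Fin n)) : EuclideanSpace ℝ (Fin n) :=
  VectorField.lieBracket ℝ (G.leftField u) (G.leftField v) 0

/-- The norm of `v ∈ T_xG` for the left-invariant Riemannian metric making `X₁, …, Xₙ`
orthonormal: `v` is translated to the identity, where the metric is the Euclidean one. -/
noncomputable def tangentNorm (x v : EuclideanSpace ℝ (Fin n)) : ℝ :=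
  ‖fderiv ℝ (G.mul (-x)) x v‖

end ExpLieGroup

/-- The span of the basis vectors `eⱼ` of degree `i`. -/
noncomputable def degreeLayer {n : ℕ} (deg : Fin n → ℕ) (i : ℕ) :
    Submodule ℝ (EuclideanSpace ℝ (Fin n)) :=
  Submodule.span ℝ {v | ∃ j, deg j = i ∧ v = EuclideanSpace.single j 1}

/-- A Carnot group of topological dimension `n` in exponential coordinates associated with an
adapted basis: the Lie algebra is `V₁ ⊕ V₂ ⊕ ⋯`, where `Vᵢ` is spanned by the basis vectors of
degree `i`, and `[V₁, Vᵢ] = Vᵢ₊₁` for `i ≥ 1`. The step `κ` is the largest degree (so `Vᵢ = 0`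
for `i > κ` and `[V₁, V_κ] = 0`). -/
structure CarnotGroup (n : ℕ) extends ExpLieGroup n where
  /-- the degree of the `j`-th basis vector field, i.e. the index of its layer -/
  degree : Fin n → ℕ
  degree_pos : ∀ j, 1 ≤ degree j
  degree_mono : Monotone degree
  bracket_layer : ∀ i, 1 ≤ i →
    Submodule.span ℝ {z | ∃ u ∈ degreeLayer degree 1, ∃ v ∈ degreeLayer degree i,
      z = toExpLieGroup.bracket u v} = degreeLayer degree (i + 1)

namespace CarnotGroup

variable {n : ℕ} (G : CarnotGroup n)

/-- The fibre `H_xG` of the horizontal bundle: the left translate of the first layer. -/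
noncomputable def horizontalSpace (x : EuclideanSpace ℝ (Fin n)) :
    Submodule ℝ (EuclideanSpace ℝ (Fin n)) :=
  (degreeLayer G.degree 1).map (fderiv ℝ (G.mul x) 0).toLinearMap

/-- Lipschitz curves on `[0,1]` whose velocity is a.e. horizontal (only the restriction of `γ` to
`[0,1]` matters). -/
def IsHorizontalCurve (γ : ℝ → EuclideanSpace ℝ (Fin n)) : Prop :=
  (∃ K, LipschitzOnWith K γ (Icc 0 1)) ∧
    ∀ᵐ t ∂(volume.restrict (Icc (0 : ℝ) 1)), deriv γ t ∈ G.horizontalSpace (γ t)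

/-- The length of a curve on `[0,1]`. -/
noncomputable def curveLength (γ : ℝ → EuclideanSpace ℝ (Fin n)) : ENNReal :=
  ∫⁻ t in Icc (0 : ℝ) 1, ENNReal.ofReal (G.tangentNorm (γ t) (deriv γ t))

/-- The Carnot–Carathéodory distance. -/
noncomputable def ccDist (x y : EuclideanSpace ℝ (Fin n)) : ENNReal :=
  ⨅ γ : ℝ → EuclideanSpace ℝ (Fin n), ⨅ _ : G.IsHorizontalCurve γ ∧ γ 0 = x ∧ γ 1 = y,
    G.curveLength γ

/-- The space `P₂(G)`. -/
abbrev P2 : Type := WassersteinSpace G.ccDist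

/-- The Wasserstein distance `W_G` on `P₂(G)`. -/
noncomputable def W (μ ν : G.P2) : ENNReal := wassersteinDist G.ccDist μ.1 ν.1

/-- The entropy on `P₂(G)` with respect to the Lebesgue measure. -/
noncomputable def Ent (μ : G.P2) : EReal := relEntropy volume μ.1

/-- The descending slope of the entropy in `(P₂(G), W_G)`. -/
noncomputable def entSlope (μ : G.P2) : ENNReal := descendingSlope G.W G.Ent μ

/-- `g = Xᵢ u` in the sense of distributions on `Ω`: `∫ u div(φ Xᵢ) = - ∫ g φ` for all
`φ ∈ C^∞_c(Ω)`. (As `Xᵢ` is divergence-free, `div(φ Xᵢ)` is `Xᵢ φ`.) To be used for `u` and `g`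
locally integrable on `Ω`. -/
def IsWeakDeriv (Ω : Set (EuclideanSpace ℝ (Fin n))) (i : Fin n)
    (u g : EuclideanSpace ℝ (Fin n) → ℝ) : Prop :=
  ∀ φ : EuclideanSpace ℝ (Fin n) → ℝ, ContDiff ℝ ∞ φ → HasCompactSupport φ → tsupport φ ⊆ Ω →
    ∫ x in Ω, u x * euclideanDiv (fun y => φ y • G.X i y) x = - ∫ x in Ω, g x * φ x

/-- `u ∈ W^{1,p}_G(Ω)`: `u` and its horizontal distributional derivatives are in `L^p(Ω)`. -/
def MemSobolev (p : ENNReal) (Ω : Set (EuclideanSpace ℝ (Fin n)))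
    (u : EuclideanSpace ℝ (Fin n) → ℝ) : Prop :=
  MemLp u p (volume.restrict Ω) ∧
    ∀ i, G.degree i = 1 → ∃ g, MemLp g p (volume.restrict Ω) ∧ G.IsWeakDeriv Ω i u g

/-- `u ∈ W^{1,p}_{G,loc}(Ω)`: `u ∈ W^{1,p}_G(Ω')` for all open `Ω'` compactly contained in `Ω`. -/
def MemSobolevLoc (p : ENNReal) (Ω : Set (EuclideanSpace ℝ (Fin n)))
    (u : EuclideanSpace ℝ (Fin n) → ℝ) : Prop :=
  ∀ Ω' : Set (EuclideanSpace ℝ (Fin n)), IsOpen Ω' → IsCompact (closure Ω') → closure Ω' ⊆ Ω →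
    G.MemSobolev p Ω' u

/-- The vector field `v` is the weak horizontal gradient `∇_G u = ∑_{d(i) = 1} (Xᵢ u) Xᵢ` on the
whole group, with `Xᵢ u ∈ L¹_loc`. -/
def IsWeakHorizontalGradient (u : EuclideanSpace ℝ (Fin n) → ℝ)
    (v : EuclideanSpace ℝ (Fin n) → EuclideanSpace ℝ (Fin n)) : Prop :=
  ∃ g : Fin n → EuclideanSpace ℝ (Fin n) → ℝ,
    (∀ i, G.degree i = 1 → LocallyIntegrable (g i) ∧ G.IsWeakDeriv univ i u (g i)) ∧
    ∀ᵐ x, v x = ∑ i with G.degree i = 1, g i x • G.X i x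

/-- The norm of `L²_G(μ)`. -/
noncomputable def l2Norm (μ : Measure (EuclideanSpace ℝ (Fin n)))
    (w : EuclideanSpace ℝ (Fin n) → EuclideanSpace ℝ (Fin n)) : ENNReal :=
  eLpNorm (fun x => G.tangentNorm x (w x)) 2 μ

end CarnotGroup

/-! Transport `μ` along a horizontal test field. For smooth compactly supported `φ` with values in
the first layer, let `T_t(x) = x · (t φ(x))`. Each `x` is joined to `T_t(x)` by a horizontal curve
of length `t ‖φ(x)‖`, so the Wasserstein distance from `μ` to its push-forward is at most `t
‖φ‖_{L²(μ)}` (`wassersteinDist_map_le`). For small `t` the map is a diffeomorphism, and by change of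
variables the entropy drops by exactly `∫ log det DT_t dμ` (`relEntropy_map_homeomorph`). After
division by `t` this tends to `∫ div(∑ φᵢ Xᵢ) dμ`, so the definition of the slope gives `∫ div(∑ φᵢ
Xᵢ) dμ ≤ |D⁻Ent|(μ) ‖φ‖_{L²(μ)}` (`ofReal_integral_euclideanDiv_le`).

The left side is linear in `φ`, so Riesz represents it by some `h ∈ L²(μ)` of norm at most the slope
(`exists_representing_field`). Testing with `φ eᵢ` yields `Xᵢ ρ = -ρ hᵢ` in the weak sense, and `w`
is the left-invariant field built from the horizontal part of `-h`. -/

/-! ### Determinants near the identity, perturbations of the identity, Riesz representation. -/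

section Analysis

open Topology
open scoped NNReal

/-- A `C¹` family `h (t, x)` vanishing at `t = 0` and for `x` off a compact set is `O(|t|)`,
uniformly in `x`. -/
theorem exists_norm_le_mul_abs_of_contDiff {E F : Type*} [NormedAddCommGroup E] [NormedSpace ℝ E]
    [NormedAddCommGroup F] [NormedSpace ℝ F] {h : ℝ × E → F} (hh : ContDiff ℝ 1 h) {K : Set E}
    (hK : IsCompact K) (h0 : ∀ x, h (0, x) = 0) (hoff : ∀ t, ∀ x ∉ K, h (t, x) = 0) :
    ∃ C, 0 < C ∧ ∀ t : ℝ, |t| ≤ 1 → ∀ x, ‖h (t, x)‖ ≤ C * |t| := by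
  have hc : Continuous (fun p : ℝ × E => fderiv ℝ h p (1, 0)) :=
    (hh.continuous_fderiv (by simp)).clm_apply continuous_const
  obtain ⟨C, hC⟩ := ((isCompact_Icc (a := (-1 : ℝ)) (b := 1)).prod hK).exists_bound_of_continuousOn
    hc.continuousOn
  refine ⟨max C 1, by positivity, fun t ht x => ?_⟩
  by_cases hx : x ∈ K
  · have hd : ∀ s ∈ Icc (-1 : ℝ) 1,
        HasDerivWithinAt (fun s => h (s, x)) (fderiv ℝ h (s, x) (1, 0)) (Icc (-1) 1) s := by
      intro s _
      have h1 : HasDerivAt (fun s : ℝ => (s, x)) (1, 0) s :=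
        (hasDerivAt_id s).prodMk (hasDerivAt_const s x)
      exact ((hh.differentiable (by simp) (s, x)).hasFDerivAt.comp_hasDerivAt s h1).hasDerivWithinAt
    have := (convex_Icc (-1 : ℝ) 1).norm_image_sub_le_of_norm_hasDerivWithin_le hd
      (fun s hs => hC (s, x) ⟨hs, hx⟩) (x := 0) (y := t) (by simp) (abs_le.1 ht)
    simp only [h0, sub_zero, Real.norm_eq_abs] at this
    exact this.trans (by gcongr; exact le_max_left _ _)
  · rw [hoff t x hx, norm_zero]; positivity

section Det

variable {E : Type*} [NormedAddCommGroup E] [NormedSpace ℝ E] [FiniteDimensional ℝ E]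

/-- By the Leibniz formula the determinant is a polynomial in the matrix entries, which are
continuous linear in `A`. -/
theorem differentiable_continuousLinearMap_det :
    Differentiable ℝ (fun A : E →L[ℝ] E => A.det) := by
  let b := Module.finBasis ℝ E
  have h : (fun A : E →L[ℝ] E => A.det) = fun A => ∑ σ : Equiv.Perm (Fin (Module.finrank ℝ E)),
      ((Equiv.Perm.sign σ : ℤ) : ℝ) *
        ∏ i, (LinearMap.toContinuousLinearMap (b.coord (σ i))) (A (b i)) := by
    ext A
    change LinearMap.det (A : E →ₗ[ℝ] E) = _
    rw [← LinearMap.det_toMatrix b, Matrix.det_apply']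
    simp [LinearMap.toMatrix_apply]
  rw [h]
  fun_prop

theorem hasFDerivAt_continuousLinearMap_det_one :
    HasFDerivAt (fun A : E →L[ℝ] E => A.det)
      (fderiv ℝ (fun A : E →L[ℝ] E => A.det) 1) 1 :=
  (differentiable_continuousLinearMap_det 1).hasFDerivAt

/-- Compare with the expansion `det (1 + t M) = 1 + t tr M + O(t²)`; the polynomial `q` is what
remains of the determinant after two divisions by `t`. -/
theorem fderiv_continuousLinearMap_det_one (M : E →L[ℝ] E) :
    fderiv ℝ (fun A : E →L[ℝ] E => A.det) 1 M = LinearMap.trace ℝ E M := by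
  let b := Module.finBasis ℝ E
  have hl : HasDerivAt (fun t : ℝ => (1 + t • M : E →L[ℝ] E)) M 0 := by
    simpa using ((hasDerivAt_id (0 : ℝ)).smul_const M).const_add 1
  have h1 := HasFDerivAt.comp_hasDerivAt_of_eq (0 : ℝ)
    (hasFDerivAt_continuousLinearMap_det_one (E := E)) hl (by simp)
  let N := LinearMap.toMatrix b b (M : E →ₗ[ℝ] E)
  let q := (Matrix.det (1 + (Polynomial.X : Polynomial ℝ) • N.map Polynomial.C)).divX.divX
  have hdet : ∀ t : ℝ, (1 + t • M : E →L[ℝ] E).det = 1 + N.trace * t + q.eval t * t ^ 2 := by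
    intro t
    rw [← Matrix.det_one_add_smul]
    change LinearMap.det ((1 + t • M : E →L[ℝ] E) : E →ₗ[ℝ] E) = _
    rw [← LinearMap.det_toMatrix b]
    congr 1
    change LinearMap.toMatrix b b (LinearMap.id + t • (M : E →ₗ[ℝ] E)) = _
    rw [map_add, map_smul, LinearMap.toMatrix_id]
  have h2 : HasDerivAt (fun t : ℝ => (1 + t • M : E →L[ℝ] E).det) N.trace 0 := by
    simp_rw [hdet]
    have := (((hasDerivAt_id' (0 : ℝ)).const_mul N.trace).const_add 1).fun_add
      ((q.hasDerivAt 0).fun_mul ((hasDerivAt_id' (0 : ℝ)).fun_pow 2))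
    exact this.congr_deriv (by simp)
  rw [LinearMap.trace_eq_matrix_trace ℝ b]
  exact h1.unique h2

/-- Near the identity, `det A - 1` is controlled by `‖A - 1‖`. -/
theorem exists_abs_det_sub_one_le :
    ∃ C δ : ℝ, 0 < C ∧ 0 < δ ∧ ∀ A : E →L[ℝ] E, ‖A - 1‖ < δ → |A.det - 1| ≤ C * ‖A - 1‖ := by
  have h := (hasFDerivAt_continuousLinearMap_det_one (E := E)).isBigO_sub
  obtain ⟨C, hC, hb⟩ := h.exists_pos
  obtain ⟨δ, hδ, hb⟩ := Metric.eventually_nhds_iff.1 hb.bound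
  refine ⟨C, δ, hC, hδ, fun A hA => ?_⟩
  have := hb (y := A) (by rwa [dist_eq_norm])
  have h1 : (1 : E →L[ℝ] E).det = 1 := LinearMap.det_id
  simpa [h1] using this

end Det

theorem euclideanDiv_eq_trace {n : ℕ} (V : EuclideanSpace ℝ (Fin n) → EuclideanSpace ℝ (Fin n))
    (x : EuclideanSpace ℝ (Fin n)) :
    euclideanDiv V x = LinearMap.trace ℝ _ (fderiv ℝ V x : _ →ₗ[ℝ] EuclideanSpace ℝ (Fin n)) := by
  rw [LinearMap.trace_eq_matrix_trace ℝ (EuclideanSpace.basisFun (Fin n) ℝ).toBasis]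
  simp [euclideanDiv, Matrix.trace, LinearMap.toMatrix_apply]

/-- A map at Lipschitz distance less than one from the identity is a homeomorphism. -/
theorem exists_homeomorph_of_lipschitzWith_sub_id {E : Type*} [NormedAddCommGroup E]
    [NormedSpace ℝ E] [CompleteSpace E] {f : E → E} {c : ℝ≥0} (hc : c < 1)
    (hf : LipschitzWith c (fun x => f x - x)) : ∃ T : E ≃ₜ E, ⇑T = f := by
  have happ : ApproximatesLinearOn f ((ContinuousLinearEquiv.refl ℝ E : E ≃L[ℝ] E) : E →L[ℝ] E)
      univ c := by
    intro x _ y _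
    have := hf.dist_le_mul x y
    rw [dist_eq_norm, dist_eq_norm] at this
    refine le_trans (le_of_eq ?_) this
    congr 1
    simp only [ContinuousLinearEquiv.coe_refl, ContinuousLinearMap.coe_id', id_eq]
    abel
  -- The trivial space is set apart because its identity has norm zero.
  have hN : Subsingleton E ∨
      c < ‖((ContinuousLinearEquiv.refl ℝ E).symm : E →L[ℝ] E)‖₊⁻¹ := by
    rcases subsingleton_or_nontrivial E with h | h
    · exact Or.inl h
    · right
      have : ‖((ContinuousLinearEquiv.refl ℝ E).symm : E →L[ℝ] E)‖₊ = 1 :=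
        NNReal.eq (ContinuousLinearMap.norm_id (𝕜 := ℝ) (E := E))
      rw [this]; simpa using hc
  exact ⟨happ.toHomeomorph f hN, rfl⟩

/-- Riesz representation for a functional dominated by the norm of a linear map into a Hilbert
space. -/
theorem exists_inner_eq_of_le_norm {D H : Type*} [AddCommGroup D] [Module ℝ D]
    [NormedAddCommGroup H] [InnerProductSpace ℝ H] [CompleteSpace H] (T : D →ₗ[ℝ] H)
    (L : D →ₗ[ℝ] ℝ) {S : ℝ} (hS : 0 ≤ S) (hL : ∀ d, L d ≤ S * ‖T d‖) :
    ∃ h : H, ‖h‖ ≤ S ∧ ∀ d, L d = inner ℝ h (T d) := by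
  have habs : ∀ d, |L d| ≤ S * ‖T d‖ := fun d => abs_le.2
    ⟨by have := hL (-d); simp only [map_neg, norm_neg] at this; linarith, hL d⟩
  -- Domination makes `L` vanish on the kernel of `T`, so `L` descends to the range of `T`;
  -- Hahn–Banach then extends it to `H` without increasing the norm.
  have hker : LinearMap.ker T.rangeRestrict ≤ LinearMap.ker L := by
    intro d hd
    rw [LinearMap.ker_rangeRestrict, LinearMap.mem_ker] at hd
    have := habs d
    rw [hd, norm_zero, mul_zero] at this
    exact abs_eq_zero.1 (le_antisymm this (abs_nonneg _))
  obtain ⟨g, hg⟩ : ∃ g : LinearMap.range T →ₗ[ℝ] ℝ, g ∘ₗ T.rangeRestrict = L := by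
    obtain ⟨r, hr⟩ := T.rangeRestrict.exists_rightInverse_of_surjective T.range_rangeRestrict
    refine ⟨L ∘ₗ r, LinearMap.ext fun d => ?_⟩
    have : r (T.rangeRestrict d) - d ∈ LinearMap.ker T.rangeRestrict := by
      rw [LinearMap.mem_ker, map_sub, ← LinearMap.comp_apply, hr, LinearMap.id_apply, sub_self]
    have := hker this
    rw [LinearMap.mem_ker, map_sub, sub_eq_zero] at this
    exact this
  have hgb : ∀ y, ‖g y‖ ≤ S * ‖y‖ := by
    rintro ⟨_, d, rfl⟩
    have : g ⟨T d, d, rfl⟩ = L d := by rw [← hg]; rfl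
    rw [this]; exact habs d
  obtain ⟨f, hf, hfn⟩ := exists_extension_norm_eq _ (g.mkContinuous S hgb)
  refine ⟨(InnerProductSpace.toDual ℝ H).symm f, ?_, fun d => ?_⟩
  · rw [LinearIsometryEquiv.norm_map, hfn]
    exact g.mkContinuous_norm_le hS hgb
  · rw [InnerProductSpace.toDual_symm_apply]
    have := hf (T.rangeRestrict d)
    rw [LinearMap.mkContinuous_apply, ← LinearMap.comp_apply, hg] at this
    exact this.symm

end Analysis

/-! ### Entropy and its transformation under diffeomorphisms. -/

section Entropy

variable {X : Type*} [MeasurableSpace X]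

theorem relEntropy_eq_integral {m μ : Measure X} (hμ : μ ≪ m)
    (hi : Integrable (fun x => (μ.rnDeriv m x).toReal * Real.log (μ.rnDeriv m x).toReal) m) :
    relEntropy m μ =
      ((∫ x, (μ.rnDeriv m x).toReal * Real.log (μ.rnDeriv m x).toReal ∂m : ℝ) : EReal) := by
  have h1 := hi.lintegral_lt_top.ne
  have h2 := hi.neg.lintegral_lt_top.ne
  simp only [Pi.neg_apply] at h2
  rw [relEntropy, if_pos hμ, integral_eq_lintegral_pos_part_sub_lintegral_neg_part hi,
    EReal.coe_sub, EReal.coe_ennreal_toReal h1, EReal.coe_ennreal_toReal h2]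

theorem absolutelyContinuous_of_relEntropy_ne_top {m μ : Measure X} (h : relEntropy m μ ≠ ⊤) :
    μ ≪ m := by
  by_contra hc
  exact h (by rw [relEntropy, if_neg hc])

theorem integrable_of_relEntropy_finite {m μ : Measure X} (h : relEntropy m μ ≠ ⊤)
    (h' : relEntropy m μ ≠ ⊥) :
    Integrable (fun x => (μ.rnDeriv m x).toReal * Real.log (μ.rnDeriv m x).toReal) m := by
  have hac := absolutelyContinuous_of_relEntropy_ne_top h
  rw [relEntropy, if_pos hac] at h h'
  have hm : Measurable (fun x => (μ.rnDeriv m x).toReal * Real.log (μ.rnDeriv m x).toReal) := by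
    have := Measure.measurable_rnDeriv μ m
    fun_prop
  refine ⟨hm.aestronglyMeasurable, ?_⟩
  -- In `EReal`, subtracting `⊤` always gives `⊥`, even from `⊤`; excluding `⊥` therefore bounds the
  -- negative part, after which excluding `⊤` bounds the positive part.
  have hB : ∫⁻ x, ENNReal.ofReal
      (-((μ.rnDeriv m x).toReal * Real.log (μ.rnDeriv m x).toReal)) ∂m ≠ ⊤ := by
    intro hB
    rw [hB] at h'
    exact h' (by simp)
  have hA : ∫⁻ x, ENNReal.ofReal
      ((μ.rnDeriv m x).toReal * Real.log (μ.rnDeriv m x).toReal) ∂m ≠ ⊤ := by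
    intro hA
    rw [hA] at h
    refine h ?_
    rw [EReal.coe_ennreal_top]
    exact EReal.top_sub (by simpa using hB)
  have hsum : ∀ a : ℝ, ‖a‖ₑ ≤ ENNReal.ofReal a + ENNReal.ofReal (-a) := by
    intro a
    rw [← ofReal_norm, Real.norm_eq_abs]
    rcases le_total 0 a with ha | ha
    · rw [abs_of_nonneg ha]; exact le_self_add
    · rw [abs_of_nonpos ha]; exact le_add_self
  refine lt_of_le_of_lt (lintegral_mono fun x => hsum _) ?_
  rw [lintegral_add_left (by fun_prop)]
  exact ENNReal.add_lt_top.2 ⟨hA.lt_top, hB.lt_top⟩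

variable {E : Type*} [NormedAddCommGroup E] [NormedSpace ℝ E] [FiniteDimensional ℝ E]
  [MeasurableSpace E] [BorelSpace E]

/-- The density of the push-forward of `μ` under a diffeomorphism `T`. -/
theorem map_eq_withDensity_of_homeomorph {m μ : Measure E} [m.IsAddHaarMeasure] [SigmaFinite μ]
    (hμ : μ ≪ m) (T : E ≃ₜ E) {T' : E → E →L[ℝ] E} (hT : ∀ x, HasFDerivAt T (T' x) x)
    (hdet : ∀ x, 0 < (T' x).det) :
    μ.map T = m.withDensity
      (fun y => μ.rnDeriv m (T.symm y) / ENNReal.ofReal (T' (T.symm y)).det) := by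
  ext A hA
  have hr := Measure.measurable_rnDeriv μ m
  rw [Measure.map_apply T.measurable hA, withDensity_apply _ hA]
  conv_lhs => rw [← Measure.withDensity_rnDeriv_eq μ m hμ]
  rw [withDensity_apply _ (T.measurable hA)]
  have himg : T '' (T ⁻¹' A) = A := T.image_preimage A
  rw [← himg, lintegral_image_eq_lintegral_abs_det_fderiv_mul m (T.measurable hA)
    (fun x _ => (hT x).hasFDerivWithinAt) T.injective.injOn, himg]
  refine lintegral_congr fun x => ?_
  rw [abs_of_pos (hdet x), T.symm_apply_apply, ENNReal.mul_div_cancel]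
  · simpa using hdet x
  · exact ENNReal.ofReal_ne_top

/-- The entropy of the push-forward of `μ` under a diffeomorphism `T`. -/
theorem relEntropy_map_homeomorph {m μ : Measure E} [m.IsAddHaarMeasure] [SigmaFinite μ]
    (hμ : μ ≪ m)
    (hi : Integrable (fun x => (μ.rnDeriv m x).toReal * Real.log (μ.rnDeriv m x).toReal) m)
    (T : E ≃ₜ E) {T' : E → E →L[ℝ] E} (hT : ∀ x, HasFDerivAt T (T' x) x)
    (hT'm : Measurable T') (hdet : ∀ x, 0 < (T' x).det)
    (hlog : Integrable (fun x => Real.log (T' x).det) μ) :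
    relEntropy m (μ.map T) =
      ((∫ x, (μ.rnDeriv m x).toReal * Real.log (μ.rnDeriv m x).toReal ∂m
        - ∫ x, Real.log (T' x).det ∂μ : ℝ) : EReal) := by
  set r := μ.rnDeriv m with hrdef
  have hr : Measurable r := Measure.measurable_rnDeriv μ m
  have hmap := map_eq_withDensity_of_homeomorph hμ T hT hdet
  rw [← hrdef] at hmap
  set σ : E → ENNReal := fun y => r (T.symm y) / ENNReal.ofReal (T' (T.symm y)).det with hσ
  have hdetm : Measurable (fun x => (T' x).det) :=
    ContinuousLinearMap.continuous_det.measurable.comp hT'm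
  have hσm : Measurable σ :=
    (hr.comp T.symm.measurable).div ((hdetm.comp T.symm.measurable).ennreal_ofReal)
  have hrn : (μ.map T).rnDeriv m =ᵐ[m] σ := by
    rw [hmap]; exact Measure.rnDeriv_withDensity m hσm
  have hac : μ.map T ≪ m := by rw [hmap]; exact withDensity_absolutelyContinuous _ _
  -- The Jacobian of the change of variables cancels the one dividing the density, leaving only its
  -- logarithm. Points of zero density are separate, as `log (a / b)` splits only for `a ≠ 0`.
  have hpt : ∀ x, |(T' x).det| • ((σ (T x)).toReal * Real.log (σ (T x)).toReal) =
      (r x).toReal * Real.log (r x).toReal - (r x).toReal • Real.log (T' x).det := by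
    intro x
    have hd := hdet x
    have h1 : (σ (T x)).toReal = (r x).toReal / (T' x).det := by
      simp only [hσ, T.symm_apply_apply, ENNReal.toReal_div, ENNReal.toReal_ofReal hd.le]
    rw [h1, abs_of_pos hd, smul_eq_mul, smul_eq_mul]
    rcases eq_or_ne (r x).toReal 0 with h0 | h0
    · simp [h0]
    · rw [Real.log_div h0 hd.ne']
      field_simp
  have hlog' : Integrable (fun x => (r x).toReal • Real.log (T' x).det) m :=
    (integrable_rnDeriv_smul_iff hμ).2 hlog
  have himg : T '' univ = univ := by simp
  have hTd : ∀ x ∈ (univ : Set E), HasFDerivWithinAt T (T' x) univ x :=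
    fun x _ => (hT x).hasFDerivWithinAt
  have hσi : Integrable (fun y => (σ y).toReal * Real.log (σ y).toReal) m := by
    have := integrableOn_image_iff_integrableOn_abs_det_fderiv_smul m MeasurableSet.univ hTd
      T.injective.injOn (fun y => (σ y).toReal * Real.log (σ y).toReal)
    rw [himg, integrableOn_univ, integrableOn_univ] at this
    rw [this]
    simp_rw [hpt]
    exact hi.sub hlog'
  have hσint : ∫ y, (σ y).toReal * Real.log (σ y).toReal ∂m =
      ∫ x, (r x).toReal * Real.log (r x).toReal ∂m - ∫ x, Real.log (T' x).det ∂μ := by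
    have := integral_image_eq_integral_abs_det_fderiv_smul m MeasurableSet.univ hTd
      T.injective.injOn (fun y => (σ y).toReal * Real.log (σ y).toReal)
    rw [himg, setIntegral_univ, setIntegral_univ] at this
    rw [this]
    simp_rw [hpt]
    rw [integral_sub hi hlog', integral_rnDeriv_smul hμ]
  have hcongr : (fun x => ((μ.map T).rnDeriv m x).toReal *
      Real.log ((μ.map T).rnDeriv m x).toReal) =ᵐ[m]
      fun y => (σ y).toReal * Real.log (σ y).toReal := by
    filter_upwards [hrn] with y hy
    rw [hy]
  rw [relEntropy_eq_integral hac (hσi.congr hcongr.symm), integral_congr_ae hcongr, hσint]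

end Entropy

/-! ### Horizontal segments and the triangle inequality for the Carnot–Carathéodory distance. -/

section CCDistance

open Topology
open scoped NNReal

namespace ExpLieGroup

variable {n : ℕ} (G : ExpLieGroup n)

theorem contDiff_mul_left (x : EuclideanSpace ℝ (Fin n)) : ContDiff ℝ ∞ (G.mul x) :=
  G.contDiff_mul.comp (contDiff_const.prodMk contDiff_id)

theorem neg_mul_self (x : EuclideanSpace ℝ (Fin n)) : G.mul (-x) x = 0 := by
  simpa using G.smul_mul_smul (-1) 1 x

theorem self_mul_neg (x : EuclideanSpace ℝ (Fin n)) : G.mul x (-x) = 0 := by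
  simpa using G.smul_mul_smul 1 (-1) x

theorem mul_mul_neg_cancel (x u : EuclideanSpace ℝ (Fin n)) : G.mul (G.mul x u) (-u) = x := by
  rw [G.mul_assoc, self_mul_neg, G.mul_zero]

/-- Differentiating `l_{-x} ∘ l_x = id` at the identity shows that the translation inside
`tangentNorm` undoes the one inside `leftField`. -/
theorem tangentNorm_leftField (x u : EuclideanSpace ℝ (Fin n)) :
    G.tangentNorm x (G.leftField u x) = ‖u‖ := by
  have h1 : HasFDerivAt (G.mul x) (fderiv ℝ (G.mul x) 0) 0 :=
    ((G.contDiff_mul_left x).differentiable (by simp) 0).hasFDerivAt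
  have h2 : HasFDerivAt (G.mul (-x)) (fderiv ℝ (G.mul (-x)) x) x :=
    ((G.contDiff_mul_left (-x)).differentiable (by simp) x).hasFDerivAt
  have h3 := HasFDerivAt.comp (0 : EuclideanSpace ℝ (Fin n)) (by rwa [G.mul_zero]) h1
  have h4 : (G.mul (-x) ∘ G.mul x) = id := by
    ext1 y
    simp only [Function.comp_apply, id]
    rw [← G.mul_assoc, neg_mul_self, G.zero_mul]
  rw [h4] at h3
  have h5 := h3.unique (hasFDerivAt_id 0)
  rw [tangentNorm, leftField, ← ContinuousLinearMap.comp_apply, h5]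
  rfl

/-- Since `s ↦ s u` is a one-parameter subgroup, `y · (r u) = z · ((r - s) u)` with `z = y · (s u)`,
which moves the derivative at `s` to the identity. -/
theorem hasDerivAt_mul_smul (y u : EuclideanSpace ℝ (Fin n)) (s : ℝ) :
    HasDerivAt (fun s : ℝ => G.mul y (s • u)) (G.leftField u (G.mul y (s • u))) s := by
  set z := G.mul y (s • u) with hz
  have h1 : HasFDerivAt (G.mul z) (fderiv ℝ (G.mul z) 0) 0 :=
    ((G.contDiff_mul_left z).differentiable (by simp) 0).hasFDerivAt
  have h2 : HasDerivAt (fun r : ℝ => (r - s) • u) u s := by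
    simpa using ((hasDerivAt_id' s).sub_const s).smul_const u
  have h3 := h1.comp_hasDerivAt_of_eq s h2 (by simp)
  refine h3.congr_of_eventuallyEq (Eventually.of_forall fun r => ?_)
  simp only [Function.comp_apply]
  rw [hz, G.mul_assoc, G.smul_mul_smul]
  simp

end ExpLieGroup

namespace CarnotGroup

variable {n : ℕ} (G : CarnotGroup n)

theorem leftField_mem_horizontalSpace {u : EuclideanSpace ℝ (Fin n)}
    (hu : u ∈ degreeLayer G.degree 1) (x : EuclideanSpace ℝ (Fin n)) :
    G.leftField u x ∈ G.horizontalSpace x :=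
  Submodule.mem_map_of_mem hu

/-- The curve `s ↦ y · (s u)` joins `y` to `y · u` and has constant speed `‖u‖`. -/
theorem ccDist_mul_le (y : EuclideanSpace ℝ (Fin n)) {u : EuclideanSpace ℝ (Fin n)}
    (hu : u ∈ degreeLayer G.degree 1) :
    G.ccDist y (G.mul y u) ≤ ENNReal.ofReal ‖u‖ := by
  set γ : ℝ → EuclideanSpace ℝ (Fin n) := fun s => G.mul y (s • u) with hγ
  have hsm : ContDiff ℝ 1 γ :=
    ((G.contDiff_mul_left y).of_le (by simp)).comp (contDiff_id.smul contDiff_const)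
  have hderiv : ∀ s, deriv γ s = G.leftField u (γ s) := fun s =>
    (G.hasDerivAt_mul_smul y u s).deriv
  have hhor : G.IsHorizontalCurve γ := by
    refine ⟨?_, Eventually.of_forall fun t => ?_⟩
    · exact (hsm.contDiffOn).exists_lipschitzOnWith (by simp) (convex_Icc 0 1) isCompact_Icc
    · rw [hderiv]; exact G.leftField_mem_horizontalSpace hu _
  have hlen : CarnotGroup.curveLength G γ = ENNReal.ofReal ‖u‖ := by
    simp only [curveLength, hderiv, G.tangentNorm_leftField]
    simp
  rw [← hlen]
  exact iInf₂_le γ ⟨hhor, by simp [hγ, G.mul_zero], by simp [hγ]⟩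

/-- Since `y = (y · u) · (-u)`, the forward bound applies from `y · u`; symmetry of the distance is
not needed. -/
theorem ccDist_mul_le' (y : EuclideanSpace ℝ (Fin n)) {u : EuclideanSpace ℝ (Fin n)}
    (hu : u ∈ degreeLayer G.degree 1) :
    G.ccDist (G.mul y u) y ≤ ENNReal.ofReal ‖u‖ := by
  have := G.ccDist_mul_le (G.mul y u) (neg_mem hu)
  rwa [G.mul_mul_neg_cancel, norm_neg] at this

/-- One half of a concatenation: `a = 0` is the first half of `[0,1]`, `a = 1` the second. Doubling
the speed on half the time preserves length, and horizontality is linear in the velocity. -/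
theorem horizontal_and_length_of_eqOn_Ioo {γ γ' : ℝ → EuclideanSpace ℝ (Fin n)} {a : ℝ}
    (h : ∀ s ∈ Ioo (a / 2) ((a + 1) / 2), γ s = γ' (2 * s - a))
    (hγ' : ∀ᵐ t ∂(volume.restrict (Icc (0 : ℝ) 1)), deriv γ' t ∈ G.horizontalSpace (γ' t)) :
    (∀ᵐ t, t ∈ Ioo (a / 2) ((a + 1) / 2) → deriv γ t ∈ G.horizontalSpace (γ t)) ∧
      ∫⁻ t in Ioo (a / 2) ((a + 1) / 2), ENNReal.ofReal (G.tangentNorm (γ t) (deriv γ t)) =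
        G.curveLength γ' := by
  have hd : ∀ s ∈ Ioo (a / 2) ((a + 1) / 2), deriv γ s = (2 : ℝ) • deriv γ' (2 * s - a) := by
    intro s hs
    have h1 : γ =ᶠ[𝓝 s] fun s => γ' (2 * s - a) := by
      filter_upwards [isOpen_Ioo.mem_nhds hs] with r hr using h r hr
    rw [h1.deriv_eq, deriv_comp_mul_left 2 (fun v => γ' (v - a)) s, deriv_comp_sub_const]
  have hder : ∀ s ∈ Ioo (a / 2) ((a + 1) / 2),
      HasDerivWithinAt (fun s : ℝ => 2 * s - a) 2 (Ioo (a / 2) ((a + 1) / 2)) s := by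
    intro s _
    simpa using (((hasDerivAt_id' s).const_mul 2).sub_const a).hasDerivWithinAt
  have hinj : InjOn (fun s : ℝ => 2 * s - a) (Ioo (a / 2) ((a + 1) / 2)) := by
    intro s _ t _ hst
    simp only at hst
    linarith
  have himg : (fun s : ℝ => 2 * s - a) '' Ioo (a / 2) ((a + 1) / 2) = Ioo 0 1 := by
    ext t
    simp only [mem_image, mem_Ioo]
    constructor
    · rintro ⟨s, ⟨h1, h2⟩, rfl⟩
      constructor <;> linarith
    · rintro ⟨h1, h2⟩
      exact ⟨(t + a) / 2, ⟨by linarith, by linarith⟩, by ring⟩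
  constructor
  · have hq : Measure.QuasiMeasurePreserving (fun s : ℝ => 2 * s - a) volume volume := by
      have h1 : Measure.QuasiMeasurePreserving (fun s : ℝ => 2 * s) volume volume := by
        refine ⟨by fun_prop, ?_⟩
        rw [Real.map_volume_mul_left (by norm_num)]
        exact Measure.smul_absolutelyContinuous
      exact (measurePreserving_sub_right volume a).quasiMeasurePreserving.comp h1
    rw [ae_restrict_iff' measurableSet_Icc] at hγ'
    filter_upwards [hq.ae hγ'] with s hs hmem
    rw [hd s hmem, h s hmem]
    refine Submodule.smul_mem _ _ (hs ?_)
    obtain ⟨h1, h2⟩ := hmem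
    constructor <;> linarith
  · rw [curveLength, ← setLIntegral_congr Ioo_ae_eq_Icc, ← himg,
      lintegral_image_eq_lintegral_abs_deriv_mul measurableSet_Ioo hder hinj]
    refine setLIntegral_congr_fun measurableSet_Ioo fun s hs => ?_
    rw [hd s hs, h s hs, ← ENNReal.ofReal_mul (abs_nonneg _), ExpLieGroup.tangentNorm, map_smul,
      norm_smul, Real.norm_eq_abs]
    rfl

/-- Run two competitors one after the other at double speed. The endpoints and the junction `1 / 2`
form a null set, so differentiability there is irrelevant. -/
theorem ccDist_triangle (x y z : EuclideanSpace ℝ (Fin n)) :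
    G.ccDist x z ≤ G.ccDist x y + G.ccDist y z := by
  conv_rhs => simp only [ccDist, ENNReal.iInf_add, ENNReal.add_iInf]
  refine le_iInf fun γ₂ => le_iInf fun h₂ => le_iInf fun γ₁ => le_iInf fun h₁ => ?_
  obtain ⟨⟨⟨K₁, hK₁⟩, hh₁⟩, h₁0, h₁1⟩ := h₁
  obtain ⟨⟨⟨K₂, hK₂⟩, hh₂⟩, h₂0, h₂1⟩ := h₂
  set γ : ℝ → EuclideanSpace ℝ (Fin n) := fun s => if s ≤ 1 / 2 then γ₁ (2 * s) else γ₂ (2 * s - 1)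
    with hγ
  have e₁ : ∀ s ≤ 1 / 2, γ s = γ₁ (2 * s) := fun s hs => if_pos hs
  have e₂ : ∀ s, 1 / 2 ≤ s → γ s = γ₂ (2 * s - 1) := by
    intro s hs
    rcases hs.eq_or_lt with rfl | hs
    · rw [e₁ _ le_rfl]; norm_num [h₁1, h₂0]
    · exact if_neg hs.not_ge
  have p₁ := G.horizontal_and_length_of_eqOn_Ioo (γ := γ) (γ' := γ₁) (a := 0)
    (fun s hs => by rw [e₁ s (by have := hs.2; linarith), sub_zero]) hh₁
  have p₂ := G.horizontal_and_length_of_eqOn_Ioo (γ := γ) (γ' := γ₂) (a := 1)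
    (fun s hs => e₂ s hs.1.le) hh₂
  have hcover : ∀ t ∈ Icc (0 : ℝ) 1, t ∉ ({0, 1 / 2, 1} : Set ℝ) →
      t ∈ Ioo ((0 : ℝ) / 2) ((0 + 1) / 2) ∪ Ioo ((1 : ℝ) / 2) ((1 + 1) / 2) := by
    intro t ht hne
    simp only [mem_insert_iff, mem_singleton_iff, not_or] at hne
    rcases lt_or_gt_of_ne hne.2.1 with h | h
    · exact Or.inl ⟨by simpa using lt_of_le_of_ne ht.1 (Ne.symm hne.1), by simpa using h⟩
    · exact Or.inr ⟨h, by simpa using lt_of_le_of_ne ht.2 hne.2.2⟩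
  have hnull : volume ({0, 1 / 2, 1} : Set ℝ) = 0 := (Set.toFinite _).measure_zero _
  -- The sum of the constants serves both halves; pairs on opposite sides are compared through `γ (1
  -- / 2)`.
  have d₁ : ∀ s ∈ Icc (0 : ℝ) 1, ∀ t ∈ Icc (0 : ℝ) 1, s ≤ t →
      dist (γ s) (γ t) ≤ (2 * (K₁ + K₂)) * (t - s) := by
    have a₁ : ∀ s t, 0 ≤ s → s ≤ t → t ≤ 1 / 2 → dist (γ s) (γ t) ≤ 2 * K₁ * (t - s) := by
      intro s t hs hst ht
      rw [e₁ s (hst.trans ht), e₁ t ht]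
      refine (hK₁.dist_le_mul _ ⟨by linarith, by linarith⟩ _ ⟨by linarith, by linarith⟩).trans ?_
      rw [dist_comm, Real.dist_eq, abs_of_nonneg (by linarith)]
      linarith
    have a₂ : ∀ s t, 1 / 2 ≤ s → s ≤ t → t ≤ 1 → dist (γ s) (γ t) ≤ 2 * K₂ * (t - s) := by
      intro s t hs hst ht
      rw [e₂ s hs, e₂ t (hs.trans hst)]
      refine (hK₂.dist_le_mul _ ⟨by linarith, by linarith⟩ _ ⟨by linarith, by linarith⟩).trans ?_
      rw [dist_comm, Real.dist_eq, abs_of_nonneg (by linarith)]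
      linarith
    have hp₁ : (0 : ℝ) ≤ K₁ := K₁.2
    have hp₂ : (0 : ℝ) ≤ K₂ := K₂.2
    intro s hs t ht hst
    rcases le_total t (1 / 2) with h | h
    · have := a₁ s t hs.1 hst h
      nlinarith [mul_nonneg hp₂ (sub_nonneg.2 hst)]
    · rcases le_total s (1 / 2) with h' | h'
      · have b₁ := a₁ s (1 / 2) hs.1 h' le_rfl
        have b₂ := a₂ (1 / 2) t le_rfl h ht.2
        have := dist_triangle (γ s) (γ (1 / 2)) (γ t)
        nlinarith [mul_nonneg hp₂ (sub_nonneg.2 h'), mul_nonneg hp₁ (sub_nonneg.2 h)]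
      · have := a₂ s t h' hst ht.2
        nlinarith [mul_nonneg hp₁ (sub_nonneg.2 hst)]
  have hhor : G.IsHorizontalCurve γ := by
    refine ⟨⟨2 * (K₁ + K₂), LipschitzOnWith.of_dist_le_mul fun s hs t ht => ?_⟩, ?_⟩
    · push_cast
      rcases le_total s t with h | h
      · rw [dist_comm s t, Real.dist_eq, abs_of_nonneg (sub_nonneg.2 h)]
        exact d₁ s hs t ht h
      · rw [dist_comm, Real.dist_eq, abs_of_nonneg (sub_nonneg.2 h)]
        exact d₁ t ht s hs h
    · rw [ae_restrict_iff' measurableSet_Icc]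
      filter_upwards [p₁.1, p₂.1, compl_mem_ae_iff.2 hnull] with t q₁ q₂ hne ht
      exact (hcover t ht hne).elim q₁ q₂
  have hlen : G.curveLength γ ≤ G.curveLength γ₁ + G.curveLength γ₂ := by
    rw [← p₁.2, ← p₂.2, curveLength]
    refine le_trans ?_ (lintegral_union_le _ _ _)
    refine lintegral_mono' (Measure.restrict_mono_ae ?_) le_rfl
    filter_upwards [compl_mem_ae_iff.2 hnull] with t hne ht
    exact hcover t ht hne
  refine le_trans (iInf₂_le γ ⟨hhor, ?_, ?_⟩) hlen
  · rw [e₁ 0 (by norm_num), mul_zero, h₁0]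
  · rw [e₂ 1 (by norm_num)]; norm_num [h₂1]

end CarnotGroup

end CCDistance

/-! ### Compactly supported deformations of the identity and their Jacobians. -/

section Deformation

open Topology
open scoped NNReal

variable {E : Type*} [NormedAddCommGroup E] [NormedSpace ℝ E]

/-- The derivative in the space variable of a map `Ψ (t, x)`. -/
noncomputable def spaceFDeriv (Ψ : ℝ × E → E) (t : ℝ) (x : E) : E →L[ℝ] E :=
  (fderiv ℝ Ψ (t, x)).comp (ContinuousLinearMap.inr ℝ ℝ E)

theorem hasFDerivAt_spaceFDeriv {Ψ : ℝ × E → E} (hΨ : ContDiff ℝ 2 Ψ) (t : ℝ) (x : E) :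
    HasFDerivAt (fun x => Ψ (t, x)) (spaceFDeriv Ψ t x) x := by
  have h1 : HasFDerivAt (fun x : E => (t, x)) (ContinuousLinearMap.inr ℝ ℝ E) x :=
    hasFDerivAt_prodMk_right t x
  exact HasFDerivAt.comp x (hΨ.differentiable (by simp) (t, x)).hasFDerivAt h1

theorem contDiff_spaceFDeriv {Ψ : ℝ × E → E} (hΨ : ContDiff ℝ 2 Ψ) :
    ContDiff ℝ 1 (fun p : ℝ × E => spaceFDeriv Ψ p.1 p.2) :=
  (hΨ.fderiv_right (m := 1) (by norm_num)).clm_comp contDiff_const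

theorem spaceFDeriv_zero {Ψ : ℝ × E → E} (hΨ : ContDiff ℝ 2 Ψ) (h0 : ∀ x, Ψ (0, x) = x) (x : E) :
    spaceFDeriv Ψ 0 x = 1 := by
  have h := hasFDerivAt_spaceFDeriv hΨ 0 x
  simp only [h0] at h
  exact h.unique (hasFDerivAt_id x)

/-- A compactly supported deformation of the identity consists of diffeomorphisms for small
times, with Jacobian determinants close to one. -/
theorem exists_homeomorph_of_deformation [FiniteDimensional ℝ E] {Ψ : ℝ × E → E}
    (hΨ : ContDiff ℝ 2 Ψ) (h0 : ∀ x, Ψ (0, x) = x) {K : Set E} (hK : IsCompact K)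
    (hoff : ∀ t, ∀ x ∉ K, Ψ (t, x) = x) :
    ∃ C δ : ℝ, 0 < C ∧ 0 < δ ∧ ∀ t : ℝ, |t| < δ → (∃ T : E ≃ₜ E, ⇑T = fun x => Ψ (t, x)) ∧
      ∀ x, 0 < (spaceFDeriv Ψ t x).det ∧ |Real.log (spaceFDeriv Ψ t x).det| ≤ C * |t| := by
  obtain ⟨C₁, hC₁, hb⟩ := exists_norm_le_mul_abs_of_contDiff
    (h := fun p : ℝ × E => spaceFDeriv Ψ p.1 p.2 - 1)
    ((contDiff_spaceFDeriv hΨ).sub contDiff_const) hK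
    (fun x => by simp [spaceFDeriv_zero hΨ h0]) (fun t x hx => by
      have h1 := hasFDerivAt_spaceFDeriv hΨ t x
      have h2 : (fun x => Ψ (t, x)) =ᶠ[𝓝 x] id := by
        filter_upwards [hK.isClosed.isOpen_compl.mem_nhds hx] with y hy using hoff t y hy
      have h3 := (h1.congr_of_eventuallyEq h2.symm).unique (hasFDerivAt_id x)
      simp only [h3, sub_eq_zero]
      rfl)
  simp only at hb
  obtain ⟨C₂, δ₂, hC₂, hδ₂, hdet⟩ := exists_abs_det_sub_one_le (E := E)
  -- The thresholds make, in turn, the bound on `DΨ - 1` available, `Ψ(t,·) - id` a contraction, the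
  -- determinant estimate applicable, and `|det - 1| < 1/2`. The factor 2 comes from `log d ≥ 1 -
  -- 1/d` with `1/d ≤ 2`.
  refine ⟨2 * (C₂ * C₁), min 1 (min (1 / (2 * C₁)) (min (δ₂ / C₁) (1 / (2 * (C₂ * C₁))))),
    by positivity, by positivity, fun t ht => ?_⟩
  simp only [lt_min_iff] at ht
  obtain ⟨ht1, ht2, ht3, ht4⟩ := ht
  rw [lt_div_iff₀ (by positivity)] at ht2 ht3 ht4
  have hbt := hb t ht1.le
  constructor
  · refine exists_homeomorph_of_lipschitzWith_sub_id (c := (C₁ * |t|).toNNReal) ?_ ?_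
    · rw [Real.toNNReal_lt_one]
      linarith
    · have hd : ∀ x, HasFDerivAt (fun x => Ψ (t, x) - x) (spaceFDeriv Ψ t x - 1) x :=
        fun x => (hasFDerivAt_spaceFDeriv hΨ t x).sub (hasFDerivAt_id x)
      refine lipschitzWith_of_nnnorm_fderiv_le (𝕜 := ℝ) (fun x => (hd x).differentiableAt)
        fun x => ?_
      rw [(hd x).fderiv]
      exact NNReal.le_toNNReal_of_coe_le (hbt x)
  · intro x
    have h1 := hdet (spaceFDeriv Ψ t x) (by have := hbt x; linarith)
    have h2 : C₂ * ‖spaceFDeriv Ψ t x - 1‖ ≤ C₂ * C₁ * |t| := by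
      rw [mul_assoc]; exact mul_le_mul_of_nonneg_left (hbt x) hC₂.le
    set d := (spaceFDeriv Ψ t x).det
    have h3 : |d - 1| ≤ C₂ * C₁ * |t| := h1.trans h2
    have h4 := abs_le.1 h3
    have hd : 1 / 2 < d := by linarith
    have hd0 : 0 < d := by linarith
    refine ⟨hd0, abs_le.2 ⟨?_, ?_⟩⟩
    · have h5 := Real.one_sub_inv_le_log_of_pos hd0
      have h6 : d⁻¹ ≤ 2 := by
        rw [inv_le_comm₀ hd0 (by norm_num)]; linarith
      have h7 : 1 - d⁻¹ = (d - 1) * d⁻¹ := by field_simp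
      have h8 : 0 < d⁻¹ := inv_pos.2 hd0
      nlinarith [mul_nonneg (mul_nonneg hC₂.le hC₁.le) (abs_nonneg t)]
    · have h5 := Real.log_le_sub_one_of_pos hd0
      have : 0 ≤ C₂ * C₁ * |t| := by positivity
      linarith

/-- The logarithm of the Jacobian of a deformation of the identity has as derivative at time zero
the divergence (trace of the derivative) of the initial velocity. -/
theorem hasDerivAt_log_det_spaceFDeriv [FiniteDimensional ℝ E] {Ψ : ℝ × E → E}
    (hΨ : ContDiff ℝ 2 Ψ) (h0 : ∀ x, Ψ (0, x) = x) (x : E) :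
    HasDerivAt (fun t => Real.log (spaceFDeriv Ψ t x).det)
      (LinearMap.trace ℝ E (fderiv ℝ (fun x => fderiv ℝ Ψ (0, x) (1, 0)) x : E →ₗ[ℝ] E)) 0 := by
  set A := fderiv ℝ (fderiv ℝ Ψ) (0, x) with hA
  have hA' : HasFDerivAt (fderiv ℝ Ψ) A (0, x) :=
    (((hΨ.fderiv_right (m := 1) (by norm_num)).differentiable (by simp)) (0, x)).hasFDerivAt
  have hV : HasFDerivAt (fun x => fderiv ℝ Ψ (0, x) (1, 0))
      ((ContinuousLinearMap.apply ℝ E ((1 : ℝ), (0 : E))).comp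
        (A.comp (ContinuousLinearMap.inr ℝ ℝ E))) x :=
    (ContinuousLinearMap.apply ℝ E ((1 : ℝ), (0 : E))).hasFDerivAt.comp x
      (HasFDerivAt.comp x hA' (hasFDerivAt_prodMk_right (0 : ℝ) x))
  have hD : HasDerivAt (fun t => spaceFDeriv Ψ t x)
      ((A (1, 0)).comp (ContinuousLinearMap.inr ℝ ℝ E)) 0 := by
    have h1 : HasDerivAt (fun s : ℝ => (s, x)) (1, 0) (0 : ℝ) :=
      (hasDerivAt_id _).prodMk (hasDerivAt_const _ x)
    have h2 := hA'.comp_hasDerivAt (0 : ℝ) h1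
    exact (((ContinuousLinearMap.compL ℝ E (ℝ × E) E).flip
      (ContinuousLinearMap.inr ℝ ℝ E)).hasFDerivAt.comp_hasDerivAt (0 : ℝ) h2)
  -- Symmetry of the second derivative exchanges the time derivative of the Jacobian with the space
  -- derivative of the velocity.
  have hsymm : ∀ v w, A v w = A w v :=
    (hΨ.contDiffAt (x := ((0 : ℝ), x))).isSymmSndFDerivAt (by simp)
  have hEq : (A (1, 0)).comp (ContinuousLinearMap.inr ℝ ℝ E) =
      fderiv ℝ (fun x => fderiv ℝ Ψ (0, x) (1, 0)) x := by
    rw [hV.fderiv]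
    ext v
    simp [hsymm (1, 0) (0, v)]
  rw [hEq] at hD
  have h1 : (1 : E →L[ℝ] E).det = 1 := LinearMap.det_id
  have h2 := HasFDerivAt.comp_hasDerivAt_of_eq (0 : ℝ)
    (hasFDerivAt_continuousLinearMap_det_one (E := E)) hD (spaceFDeriv_zero hΨ h0 x).symm
  rw [fderiv_continuousLinearMap_det_one] at h2
  have h3 := h2.log (by simp [spaceFDeriv_zero hΨ h0 x, h1])
  simpa [spaceFDeriv_zero hΨ h0 x, h1] using h3

end Deformation

/-! ### Push-forwards by bounded horizontal displacements. -/

namespace CarnotGroup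

variable {n : ℕ} (G : CarnotGroup n)

/-- Points move by at most `C`, so the triangle inequality and `(a + b)² ≤ 4 (a² + b²)` keep the
second moment finite. -/
theorem isProbabilityMeasure_map_and_moment {μ : Measure (EuclideanSpace ℝ (Fin n))}
    (hμ : IsProbabilityMeasure μ ∧ ∃ x₀, ∫⁻ x, G.ccDist x x₀ ^ 2 ∂μ < ⊤)
    {T u : EuclideanSpace ℝ (Fin n) → EuclideanSpace ℝ (Fin n)} (hT : Measurable T)
    (hTu : ∀ x, T x = G.mul x (u x)) (hu : ∀ x, u x ∈ degreeLayer G.degree 1) {C : ℝ}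
    (hC : ∀ x, ‖u x‖ ≤ C) :
    IsProbabilityMeasure (μ.map T) ∧ ∃ x₀, ∫⁻ x, G.ccDist x x₀ ^ 2 ∂(μ.map T) < ⊤ := by
  obtain ⟨_, x₀, hx₀⟩ := hμ
  refine ⟨Measure.isProbabilityMeasure_map hT.aemeasurable, x₀, ?_⟩
  refine (lintegral_map_le _ _).trans_lt ?_
  have hpt : ∀ x, G.ccDist (T x) x₀ ^ 2 ≤
      4 * (ENNReal.ofReal C ^ 2 + G.ccDist x x₀ ^ 2) := by
    intro x
    have h1 : G.ccDist (T x) x₀ ≤ ENNReal.ofReal C + G.ccDist x x₀ := by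
      refine (G.ccDist_triangle _ x _).trans ?_
      gcongr
      rw [hTu]
      exact (G.ccDist_mul_le' x (hu x)).trans (ENNReal.ofReal_le_ofReal (hC x))
    have h2 : ENNReal.ofReal C + G.ccDist x x₀ ≤ 2 * max (ENNReal.ofReal C) (G.ccDist x x₀) := by
      rw [two_mul]; exact add_le_add (le_max_left _ _) (le_max_right _ _)
    calc G.ccDist (T x) x₀ ^ 2 ≤ (2 * max (ENNReal.ofReal C) (G.ccDist x x₀)) ^ 2 := by
          gcongr; exact h1.trans h2
      _ = 4 * max (ENNReal.ofReal C) (G.ccDist x x₀) ^ 2 := by rw [mul_pow]; norm_num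
      _ ≤ _ := by
          gcongr
          rcases max_choice (ENNReal.ofReal C) (G.ccDist x x₀) with h | h <;> rw [h]
          · exact le_self_add
          · exact le_add_self
  refine (lintegral_mono hpt).trans_lt ?_
  rw [lintegral_const_mul' _ _ (by simp), lintegral_add_left measurable_const]
  refine ENNReal.mul_lt_top (by simp) (ENNReal.add_lt_top.2 ⟨?_, hx₀⟩)
  simp

/-- The coupling `(id, T)` is a competitor, and moving `x` to `x · u(x)` costs at most `‖u(x)‖`. -/
theorem wassersteinDist_map_le {μ : Measure (EuclideanSpace ℝ (Fin n))}
    {T u : EuclideanSpace ℝ (Fin n) → EuclideanSpace ℝ (Fin n)} (hT : Measurable T)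
    (hTu : ∀ x, T x = G.mul x (u x)) (hu : ∀ x, u x ∈ degreeLayer G.degree 1) :
    wassersteinDist G.ccDist μ (μ.map T) ≤ eLpNorm u 2 μ := by
  have hp : Measurable (fun x => (x, T x)) := measurable_id.prodMk hT
  rw [eLpNorm_eq_lintegral_rpow_enorm_toReal (by simp) (by simp), wassersteinDist]
  simp only [ENNReal.toReal_ofNat]
  gcongr
  have hfst : (μ.map fun x => (x, T x)).map Prod.fst = μ := by
    rw [Measure.map_map measurable_fst hp]
    exact Measure.map_id
  have hsnd : (μ.map fun x => (x, T x)).map Prod.snd = μ.map T := by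
    rw [Measure.map_map measurable_snd hp]
    rfl
  refine (iInf₂_le (μ.map fun x => (x, T x)) ⟨hfst, hsnd⟩).trans ?_
  refine (lintegral_map_le _ _).trans (lintegral_mono fun x => ?_)
  have : G.ccDist x (T x) ≤ ‖u x‖ₑ := by
    rw [hTu, ← ofReal_norm]
    exact G.ccDist_mul_le x (hu x)
  simpa using pow_le_pow_left' this 2

end CarnotGroup

/-! ### The slope bounds the integrated divergence. -/

namespace CarnotGroup

open Topology

variable {n : ℕ} (G : CarnotGroup n)

theorem Ent_ne_top_and_ne_bot {μ : G.P2} (h : G.entSlope μ < ⊤) : G.Ent μ ≠ ⊤ ∧ G.Ent μ ≠ ⊥ := by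
  by_contra hc
  rw [not_and_or, not_not, not_not] at hc
  rw [entSlope, descendingSlope, if_pos hc] at h
  exact lt_irrefl _ h

/-- If, along transport maps at distance at most `t N`, the entropy drops by `a t` with
`a t / t → I`, then `I` is at most `N` times the slope. -/
theorem ofReal_le_entSlope_mul {μ : G.P2} (hslope : G.entSlope μ < ⊤) {N : ENNReal} (hN : N ≠ ⊤)
    {a : ℝ → ℝ} {I : ℝ} (ha : Tendsto (fun t => a t / t) (𝓝[>] 0) (𝓝 I)) {e : ℝ}
    (he : G.Ent μ = e)
    (hν : ∀ᶠ t in 𝓝[>] (0 : ℝ), ∃ ν : G.P2, G.Ent ν = ((e - a t : ℝ) : EReal) ∧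
      G.W μ ν ≤ ENNReal.ofReal t * N) :
    ENNReal.ofReal I ≤ G.entSlope μ * N := by
  rcases le_or_gt I 0 with hI | hI
  · rw [ENNReal.ofReal_of_nonpos hI]; exact zero_le
  have hfin : ¬(G.Ent μ = ⊤ ∨ G.Ent μ = ⊥) := by
    rw [he]; simp
  -- The case `N = 0` is included: finiteness of the slope is what allows clearing the denominator
  -- there.
  rw [← ENNReal.div_le_iff_le_mul (Or.inr hslope.ne) (Or.inl hN), entSlope, descendingSlope,
    if_neg hfin]
  refine le_iInf₂ fun r hr => ?_
  have hlim : Tendsto (fun t => ENNReal.ofReal (a t / t) / N) (𝓝[>] 0)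
      (𝓝 (ENNReal.ofReal I / N)) :=
    ENNReal.Tendsto.div_const (ENNReal.tendsto_ofReal ha) (Or.inl (by simpa using hI))
  have hdist : Tendsto (fun t => ENNReal.ofReal t * N) (𝓝[>] 0) (𝓝 0) := by
    have h1 : Tendsto ENNReal.ofReal (𝓝[>] (0 : ℝ)) (𝓝 0) := by
      simpa using (ENNReal.tendsto_ofReal (tendsto_id (x := 𝓝 (0 : ℝ)))).mono_left
        (nhdsWithin_le_nhds (s := Ioi 0))
    simpa using ENNReal.Tendsto.mul_const h1 (Or.inr hN)
  refine le_of_tendsto hlim ?_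
  filter_upwards [hν, ha.eventually (lt_mem_nhds hI), self_mem_nhdsWithin,
    hdist.eventually (gt_mem_nhds hr)] with t ⟨ν, hν1, hν2⟩ hat ht hd
  have ht : 0 < t := ht
  have hat : 0 < a t := by
    rcases div_pos_iff.1 hat with h | h
    · exact h.1
    · linarith [h.2]
  -- The entropy of `ν` is strictly smaller, so `ν` is admissible in the supremum.
  have hne : ν ≠ μ := by
    rintro rfl
    rw [he, EReal.coe_eq_coe_iff] at hν1
    linarith
  refine le_trans ?_ (le_iSup₂ (f := fun (y : G.P2) (_ : y ≠ μ ∧ G.W μ y < r) =>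
    (G.Ent μ - G.Ent y).toENNReal / G.W μ y) ν ⟨hne, hν2.trans_lt hd⟩)
  have hval : (G.Ent μ - G.Ent ν).toENNReal = ENNReal.ofReal (a t) := by
    rw [he, hν1, ← EReal.coe_sub, sub_sub_cancel, EReal.toENNReal_of_ne_top (EReal.coe_ne_top _),
      EReal.toReal_coe]
  rw [hval, ENNReal.ofReal_div_of_pos ht]
  refine le_trans (le_of_eq ?_) (ENNReal.div_le_div_left hν2 _)
  rw [div_eq_mul_inv, div_eq_mul_inv, div_eq_mul_inv, ENNReal.mul_inv (Or.inr hN)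
    (Or.inl ENNReal.ofReal_ne_top), mul_assoc]

/-- The deformation `(t, x) ↦ x · (t φ(x))`. -/
noncomputable def deformation (φ : EuclideanSpace ℝ (Fin n) → EuclideanSpace ℝ (Fin n))
    (p : ℝ × EuclideanSpace ℝ (Fin n)) : EuclideanSpace ℝ (Fin n) :=
  G.mul p.2 (p.1 • φ p.2)

variable {G}
variable {φ : EuclideanSpace ℝ (Fin n) → EuclideanSpace ℝ (Fin n)}

theorem contDiff_deformation (hφ : ContDiff ℝ ∞ φ) : ContDiff ℝ ∞ (G.deformation φ) :=
  G.contDiff_mul.comp (contDiff_snd.prodMk (contDiff_fst.smul (hφ.comp contDiff_snd)))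

theorem deformation_zero (x : EuclideanSpace ℝ (Fin n)) : G.deformation φ (0, x) = x := by
  simp [deformation, G.mul_zero]

theorem deformation_of_notMem_tsupport (t : ℝ) (x : EuclideanSpace ℝ (Fin n))
    (hx : x ∉ tsupport φ) : G.deformation φ (t, x) = x := by
  simp [deformation, image_eq_zero_of_notMem_tsupport hx, G.mul_zero]

/-- Identifies the initial velocity, so that the trace in `hasDerivAt_log_det_spaceFDeriv` becomes
the divergence of `∑ φᵢ Xᵢ`. -/
theorem fderiv_deformation (hφ : ContDiff ℝ ∞ φ) (x : EuclideanSpace ℝ (Fin n)) :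
    fderiv ℝ (G.deformation φ) (0, x) (1, 0) = G.leftField (φ x) x := by
  have h1 : HasDerivAt (fun s : ℝ => (s, x)) (1, 0) (0 : ℝ) :=
    (hasDerivAt_id _).prodMk (hasDerivAt_const _ x)
  have h2 := ((contDiff_deformation (G := G) hφ).differentiable (by simp)
    (0, x)).hasFDerivAt.comp_hasDerivAt (0 : ℝ) h1
  have h3 := G.hasDerivAt_mul_smul x (φ x) 0
  rw [zero_smul, G.mul_zero] at h3
  exact h2.unique h3

/-- The first variation of the entropy along `deformation`, compared with the slope through
`ofReal_le_entSlope_mul`. -/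
theorem ofReal_integral_euclideanDiv_le {μ : G.P2} (hslope : G.entSlope μ < ⊤)
    (hφ : ContDiff ℝ ∞ φ) (hφc : HasCompactSupport φ)
    (hφh : ∀ x, φ x ∈ degreeLayer G.degree 1) :
    ENNReal.ofReal (∫ x, euclideanDiv (fun x => G.leftField (φ x) x) x ∂μ.1) ≤
      G.entSlope μ * eLpNorm φ 2 μ.1 := by
  obtain ⟨htop, hbot⟩ := G.Ent_ne_top_and_ne_bot hslope
  have : IsProbabilityMeasure μ.1 := μ.2.1
  have hac := absolutelyContinuous_of_relEntropy_ne_top htop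
  have hint := integrable_of_relEntropy_finite htop hbot
  have hΨ : ContDiff ℝ 2 (G.deformation φ) := contDiff_infty.1 (contDiff_deformation hφ) 2
  obtain ⟨C, δ, hC, hδ, hT⟩ := exists_homeomorph_of_deformation hΨ deformation_zero hφc
    deformation_of_notMem_tsupport
  obtain ⟨B, hB⟩ := hφc.exists_bound_of_continuous hφ.continuous
  have hN : eLpNorm φ 2 μ.1 ≠ ⊤ :=
    (MemLp.of_bound hφ.continuous.aestronglyMeasurable B (Eventually.of_forall hB)).eLpNorm_ne_top
  have hDm : ∀ t, Continuous (spaceFDeriv (G.deformation φ) t) := fun t =>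
    (contDiff_spaceFDeriv hΨ).continuous.comp (by fun_prop : Continuous fun x => (t, x))
  have hlm : ∀ t, Measurable (fun x => Real.log (spaceFDeriv (G.deformation φ) t x).det) :=
    fun t => Real.measurable_log.comp
      (ContinuousLinearMap.continuous_det.comp (hDm t)).measurable
  have hsmall : ∀ᶠ t in 𝓝[>] (0 : ℝ), 0 < t ∧ |t| < δ ∧ |t| < 1 := by
    filter_upwards [Ioo_mem_nhdsGT (lt_min hδ one_pos)] with t ht
    have := lt_min_iff.1 ht.2
    exact ⟨ht.1, by rw [abs_of_pos ht.1]; exact this.1, by rw [abs_of_pos ht.1]; exact this.2⟩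
  refine G.ofReal_le_entSlope_mul hslope hN
    (a := fun t => ∫ x, Real.log (spaceFDeriv (G.deformation φ) t x).det ∂μ.1) ?_
    (relEntropy_eq_integral hac hint) ?_
  -- Dominated convergence: the bound `|log det| ≤ C |t|` makes the difference quotients bounded by
  -- the constant `C`, integrable for a probability measure.
  · simp only [← integral_div]
    refine tendsto_integral_filter_of_dominated_convergence (fun _ => C)
      (Eventually.of_forall fun t => ((hlm t).div_const t).aestronglyMeasurable) ?_
      (integrable_const C) (Eventually.of_forall fun x => ?_)
    · filter_upwards [hsmall] with t ⟨h0, h1, _⟩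
      refine Eventually.of_forall fun x => ?_
      rw [norm_div, Real.norm_eq_abs, Real.norm_eq_abs, div_le_iff₀ (abs_pos.2 h0.ne')]
      exact ((hT t h1).2 x).2
    · have h := hasDerivAt_log_det_spaceFDeriv hΨ deformation_zero x
      simp only [fderiv_deformation hφ] at h
      rw [← euclideanDiv_eq_trace, hasDerivAt_iff_tendsto_slope] at h
      have h' := h.mono_left (nhdsWithin_mono (0 : ℝ) (fun t (ht : 0 < t) => ht.ne'))
      refine h'.congr fun t => ?_
      rw [slope_def_field, spaceFDeriv_zero hΨ deformation_zero]
      have h1 : (1 : EuclideanSpace ℝ (Fin n) →L[ℝ] EuclideanSpace ℝ (Fin n)).det = 1 :=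
        LinearMap.det_id
      simp [h1]
  · filter_upwards [hsmall] with t ⟨h0, h1, h2⟩
    obtain ⟨⟨T, hTeq⟩, hdet⟩ := hT t h1
    have hTx : ∀ x, T x = G.mul x (t • φ x) := fun x => by rw [hTeq]; rfl
    have hmem : ∀ x, t • φ x ∈ degreeLayer G.degree 1 := fun x => Submodule.smul_mem _ _ (hφh x)
    refine ⟨⟨μ.1.map T, G.isProbabilityMeasure_map_and_moment μ.2 T.measurable hTx hmem (C := B)
      fun x => ?_⟩, ?_, ?_⟩
    · rw [norm_smul, Real.norm_eq_abs]
      exact (mul_le_of_le_one_left (norm_nonneg _) h2.le).trans (hB x)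
    · refine relEntropy_map_homeomorph hac hint T (T' := spaceFDeriv (G.deformation φ) t)
        (fun x => ?_) (hDm t).measurable (fun x => (hdet x).1) ?_
      · rw [hTeq]; exact hasFDerivAt_spaceFDeriv hΨ t x
      · exact Integrable.of_bound (hlm t).aestronglyMeasurable (C * |t|)
          (Eventually.of_forall fun x => (hdet x).2)
    · refine (G.wassersteinDist_map_le T.measurable hTx hmem).trans (le_of_eq ?_)
      change eLpNorm (t • φ) 2 μ.1 = _
      rw [eLpNorm_const_smul, ← ofReal_norm, Real.norm_eq_abs, abs_of_pos h0]

end CarnotGroup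

/-! ### Representation of the divergence functional and horizontal projection. -/

namespace CarnotGroup

open Topology

variable {n : ℕ} (G : CarnotGroup n)

/-- Smooth compactly supported maps into the first layer, i.e. the smooth compactly supported
horizontal vector fields read in the left-invariant frame. -/
def horizontalTest : Submodule ℝ (EuclideanSpace ℝ (Fin n) → EuclideanSpace ℝ (Fin n)) where
  carrier := {φ | ContDiff ℝ ∞ φ ∧ HasCompactSupport φ ∧ ∀ x, φ x ∈ degreeLayer G.degree 1}
  add_mem' := fun ha hb => ⟨ha.1.add hb.1, ha.2.1.add hb.2.1,
    fun x => Submodule.add_mem _ (ha.2.2 x) (hb.2.2 x)⟩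
  zero_mem' := ⟨contDiff_const, HasCompactSupport.zero, fun _ => Submodule.zero_mem _⟩
  smul_mem' := fun c _ ha => ⟨contDiff_const.smul ha.1, ha.2.1.smul_left (f := fun _ => c),
    fun x => Submodule.smul_mem _ _ (ha.2.2 x)⟩

/-- The field is the time derivative at zero of a smooth deformation, which gives its regularity in
`x`. -/
theorem contDiff_leftField {φ : EuclideanSpace ℝ (Fin n) → EuclideanSpace ℝ (Fin n)}
    (hφ : ContDiff ℝ ∞ φ) : ContDiff ℝ 1 (fun x => G.leftField (φ x) x) := by
  simp_rw [← fderiv_deformation (G := G) hφ]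
  have h1 : ContDiff ℝ 1 (fderiv ℝ (G.deformation φ)) :=
    (contDiff_infty.1 (contDiff_deformation hφ) 2).fderiv_right (by norm_num)
  exact (h1.comp (contDiff_const.prodMk contDiff_id)).clm_apply contDiff_const

theorem continuous_X (i : Fin n) : Continuous (G.X i) :=
  (G.contDiff_leftField (φ := fun _ => EuclideanSpace.single i 1) contDiff_const).continuous

theorem euclideanDiv_of_notMem_tsupport
    {V : EuclideanSpace ℝ (Fin n) → EuclideanSpace ℝ (Fin n)} {x : EuclideanSpace ℝ (Fin n)}
    (hx : x ∉ tsupport V) : euclideanDiv V x = 0 := by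
  simp [euclideanDiv, fderiv_of_notMem_tsupport ℝ hx]

theorem continuous_euclideanDiv {V : EuclideanSpace ℝ (Fin n) → EuclideanSpace ℝ (Fin n)}
    (hV : ContDiff ℝ 1 V) : Continuous (euclideanDiv V) := by
  have := hV.continuous_fderiv (by simp)
  unfold euclideanDiv
  fun_prop

theorem integrable_euclideanDiv_leftField (μ : Measure (EuclideanSpace ℝ (Fin n)))
    [IsFiniteMeasure μ] {φ : EuclideanSpace ℝ (Fin n) → EuclideanSpace ℝ (Fin n)}
    (hφ : ContDiff ℝ ∞ φ) (hφc : HasCompactSupport φ) :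
    Integrable (euclideanDiv (fun x => G.leftField (φ x) x)) μ := by
  refine (continuous_euclideanDiv (G.contDiff_leftField hφ)).integrable_of_hasCompactSupport ?_
  refine HasCompactSupport.intro hφc fun x hx => euclideanDiv_of_notMem_tsupport fun hx' => hx ?_
  refine closure_mono (Function.support_subset_iff'.2 fun y hy => ?_) hx'
  simp only [Function.notMem_support.1 hy, ExpLieGroup.leftField, map_zero]

/-- The functional `φ ↦ ∫ div(∑ φᵢ Xᵢ) dμ`. -/
noncomputable def divFunctional (μ : Measure (EuclideanSpace ℝ (Fin n))) [IsFiniteMeasure μ] :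
    G.horizontalTest →ₗ[ℝ] ℝ where
  toFun φ := ∫ x, euclideanDiv (fun x => G.leftField (φ.1 x) x) x ∂μ
  map_add' := by
    rintro ⟨φ, hφ⟩ ⟨ψ, hψ⟩
    rw [← integral_add (G.integrable_euclideanDiv_leftField μ hφ.1 hφ.2.1)
      (G.integrable_euclideanDiv_leftField μ hψ.1 hψ.2.1)]
    congr 1 with x
    have h : (fun x => G.leftField ((φ + ψ) x) x) =
        fun x => G.leftField (φ x) x + G.leftField (ψ x) x := by
      ext1 x
      simp only [ExpLieGroup.leftField, Pi.add_apply, map_add]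
    change euclideanDiv (fun x => G.leftField ((φ + ψ) x) x) x = _
    rw [h]
    simp only [euclideanDiv]
    rw [fderiv_fun_add ((G.contDiff_leftField hφ.1).differentiable (by simp) x)
      ((G.contDiff_leftField hψ.1).differentiable (by simp) x)]
    simp [Finset.sum_add_distrib]
  map_smul' := by
    rintro c ⟨φ, hφ⟩
    rw [RingHom.id_apply, smul_eq_mul, ← integral_const_mul]
    congr 1 with x
    have h : (fun x => G.leftField ((c • φ) x) x) = fun x => c • G.leftField (φ x) x := by
      ext1 x
      simp only [ExpLieGroup.leftField, Pi.smul_apply, map_smul]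
    change euclideanDiv (fun x => G.leftField ((c • φ) x) x) x = _
    rw [h]
    simp only [euclideanDiv]
    rw [fderiv_fun_const_smul ((G.contDiff_leftField hφ.1).differentiable (by simp) x)]
    simp [Finset.mul_sum]

theorem memLp_of_mem_horizontalTest (μ : Measure (EuclideanSpace ℝ (Fin n))) [IsFiniteMeasure μ]
    {φ : EuclideanSpace ℝ (Fin n) → EuclideanSpace ℝ (Fin n)} (hφ : φ ∈ G.horizontalTest) :
    MemLp φ 2 μ :=
  hφ.1.continuous.memLp_of_hasCompactSupport hφ.2.1

/-- The inclusion of the horizontal test fields into `L²(μ)`. -/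
noncomputable def horizontalTestToLp (μ : Measure (EuclideanSpace ℝ (Fin n))) [IsFiniteMeasure μ] :
    G.horizontalTest →ₗ[ℝ] Lp (EuclideanSpace ℝ (Fin n)) 2 μ where
  toFun φ := (G.memLp_of_mem_horizontalTest μ φ.2).toLp φ.1
  map_add' _ _ := rfl
  map_smul' _ _ := rfl

/-- Riesz is applied in `L²(μ)` with values in all of `ℝⁿ`, so `h` need not be horizontal; only its
first-layer components are seen by the test fields. -/
theorem exists_representing_field {μ : G.P2} (hslope : G.entSlope μ < ⊤) :
    ∃ h : EuclideanSpace ℝ (Fin n) → EuclideanSpace ℝ (Fin n), Measurable h ∧ MemLp h 2 μ.1 ∧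
      eLpNorm h 2 μ.1 ≤ G.entSlope μ ∧ ∀ φ ∈ G.horizontalTest,
        ∫ x, euclideanDiv (fun x => G.leftField (φ x) x) x ∂μ.1 =
          ∫ x, inner ℝ (h x) (φ x) ∂μ.1 := by
  have : IsProbabilityMeasure μ.1 := μ.2.1
  obtain ⟨h, hn, hh⟩ := exists_inner_eq_of_le_norm (G.horizontalTestToLp μ.1)
    (G.divFunctional μ.1) (S := (G.entSlope μ).toReal) ENNReal.toReal_nonneg fun φ => by
      have h1 := ofReal_integral_euclideanDiv_le hslope φ.2.1 φ.2.2.1 φ.2.2.2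
      have h2 := (G.memLp_of_mem_horizontalTest μ.1 φ.2).eLpNorm_ne_top
      have h3 : ‖G.horizontalTestToLp μ.1 φ‖ = (eLpNorm φ.1 2 μ.1).toReal := 
        Lp.norm_toLp _ (G.memLp_of_mem_horizontalTest μ.1 φ.2)
      rw [h3, ← ENNReal.toReal_mul]
      exact (ENNReal.ofReal_le_iff_le_toReal (ENNReal.mul_ne_top hslope.ne h2)).1 h1
  refine ⟨h, (Lp.stronglyMeasurable h).measurable, Lp.memLp h, ?_, fun φ hφ => ?_⟩
  · rw [Lp.norm_def] at hn
    exact (ENNReal.toReal_le_toReal (Lp.eLpNorm_ne_top h) hslope.ne).1 hn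
  · refine (hh ⟨φ, hφ⟩).trans ?_
    rw [L2.inner_def]
    refine integral_congr_ae ?_
    filter_upwards [(G.memLp_of_mem_horizontalTest μ.1 hφ).coeFn_toLp] with x hx
    change inner ℝ (h x) ((G.memLp_of_mem_horizontalTest μ.1 hφ).toLp φ x) = _
    rw [hx]

variable {G}

theorem IsWeakDeriv.of_univ {i : Fin n} {u g : EuclideanSpace ℝ (Fin n) → ℝ}
    (h : G.IsWeakDeriv univ i u g) (Ω : Set (EuclideanSpace ℝ (Fin n))) :
    G.IsWeakDeriv Ω i u g := by
  intro φ hφ hc hs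
  have h1 := h φ hφ hc (subset_univ _)
  rw [setIntegral_univ, setIntegral_univ] at h1
  rw [setIntegral_eq_integral_of_forall_compl_eq_zero, h1,
    setIntegral_eq_integral_of_forall_compl_eq_zero]
  · intro x hx
    rw [image_eq_zero_of_notMem_tsupport fun h => hx (hs h), mul_zero]
  · intro x hx
    rw [euclideanDiv_of_notMem_tsupport, mul_zero]
    exact fun h => hx (hs (tsupport_smul_subset_left φ (G.X i) h))

variable (G)

/-- The projection onto the first layer. -/
noncomputable def horizontalPart (u : EuclideanSpace ℝ (Fin n)) : EuclideanSpace ℝ (Fin n) :=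
  ∑ i with G.degree i = 1, u i • EuclideanSpace.single i 1

theorem horizontalPart_mem (u : EuclideanSpace ℝ (Fin n)) :
    G.horizontalPart u ∈ degreeLayer G.degree 1 := by
  refine Submodule.sum_mem _ fun i hi => Submodule.smul_mem _ _ (Submodule.subset_span ?_)
  exact ⟨i, (Finset.mem_filter.1 hi).2, rfl⟩

/-- Discarding the other coordinates lets the `L²` bound on `h` pass to the horizontal field `w`. -/
theorem norm_horizontalPart_le (u : EuclideanSpace ℝ (Fin n)) : ‖G.horizontalPart u‖ ≤ ‖u‖ := by
  have h : ∀ j, G.horizontalPart u j = if G.degree j = 1 then u j else 0 := by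
    intro j
    rw [horizontalPart, WithLp.ofLp_sum, Finset.sum_apply, Finset.sum_filter]
    simp only [PiLp.smul_apply, PiLp.single_apply, smul_eq_mul, mul_ite, mul_one, mul_zero]
    rw [Finset.sum_eq_single j]
    · simp
    · intro i _ hij
      simp [hij.symm]
    · simp
  rw [EuclideanSpace.norm_eq, EuclideanSpace.norm_eq]
  refine Real.sqrt_le_sqrt (Finset.sum_le_sum fun j _ => ?_)
  rw [h]
  split_ifs
  · exact le_rfl
  · simp [sq_nonneg]

theorem leftField_horizontalPart (u x : EuclideanSpace ℝ (Fin n)) :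
    G.leftField (G.horizontalPart u) x = ∑ i with G.degree i = 1, u i • G.X i x := by
  simp only [ExpLieGroup.leftField, horizontalPart, map_sum, map_smul, ExpLieGroup.X]

end CarnotGroup

/-! ### Passing from `μ` to its density `ρ`, and the conclusion. -/

section Density

variable {X : Type*} [MeasurableSpace X] {m : Measure X} {ρ : X → ℝ}

theorem integral_withDensity_ofReal (hρ_meas : AEMeasurable ρ m) (hρ_nonneg : ∀ᵐ x ∂m, 0 ≤ ρ x)
    (f : X → ℝ) :
    ∫ x, f x ∂(m.withDensity fun x => ENNReal.ofReal (ρ x)) = ∫ x, ρ x * f x ∂m := by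
  rw [integral_withDensity_eq_integral_toReal_smul₀ hρ_meas.ennreal_ofReal (by simp)]
  refine integral_congr_ae ?_
  filter_upwards [hρ_nonneg] with x hx
  rw [ENNReal.toReal_ofReal hx, smul_eq_mul]

theorem Integrable.mul_of_withDensity_ofReal (hρ_meas : AEMeasurable ρ m)
    (hρ_nonneg : ∀ᵐ x ∂m, 0 ≤ ρ x) {f : X → ℝ}
    (hf : Integrable f (m.withDensity fun x => ENNReal.ofReal (ρ x))) :
    Integrable (fun x => ρ x * f x) m := by
  rw [integrable_withDensity_iff_integrable_smul₀' hρ_meas.ennreal_ofReal (by simp)] at hf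
  refine hf.congr ?_
  filter_upwards [hρ_nonneg] with x hx
  rw [ENNReal.toReal_ofReal hx, smul_eq_mul]

end Density

theorem mainTheorem6 {n : ℕ} (G : CarnotGroup n) (ρ : EuclideanSpace ℝ (Fin n) → ℝ)
    (hρ_meas : AEMeasurable ρ volume) (hρ_nonneg : ∀ᵐ x, 0 ≤ ρ x) (μ : G.P2)
    (hμ : μ.1 = volume.withDensity (fun x => ENNReal.ofReal (ρ x)))
    (hslope : G.entSlope μ < ⊤) :
    G.MemSobolevLoc 1 univ ρ ∧
      ∃ w : EuclideanSpace ℝ (Fin n) → EuclideanSpace ℝ (Fin n),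
        Measurable w ∧ (∀ x, w x ∈ G.horizontalSpace x) ∧
        G.IsWeakHorizontalGradient ρ (fun x => ρ x • w x) ∧
        G.l2Norm μ.1 w ≤ G.entSlope μ := by
  have : IsProbabilityMeasure μ.1 := μ.2.1
  obtain ⟨h, hm, hL2, hnorm, hrep⟩ := G.exists_representing_field hslope
  have hcoord : ∀ i, Measurable fun x => (-h x) i := fun i =>
    (EuclideanSpace.proj (𝕜 := ℝ) i).continuous.measurable.comp hm.neg
  have hρi : Integrable ρ := by
    have h1 : Integrable (fun _ => (1 : ℝ)) μ.1 := integrable_const 1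
    rw [hμ] at h1
    simpa using Integrable.mul_of_withDensity_ofReal hρ_meas hρ_nonneg h1
  -- As `μ` is finite, `h ∈ L²(μ)` is in `L¹(μ)`, which makes `ρ hᵢ` integrable for the Lebesgue
  -- measure on the whole group.
  have hgi : ∀ i, Integrable fun x => ρ x * (-h x) i := by
    intro i
    have h1 : Integrable (fun x => (-h x) i) μ.1 :=
      (EuclideanSpace.proj (𝕜 := ℝ) i).integrable_comp (hL2.integrable (by norm_num)).neg
    rw [hμ] at h1
    exact Integrable.mul_of_withDensity_ofReal hρ_meas hρ_nonneg h1
  have hweak : ∀ i, G.degree i = 1 → G.IsWeakDeriv univ i ρ fun x => ρ x * (-h x) i := by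
    intro i hi φ hφ hc _
    -- The test field `φ eᵢ` isolates the derivative along `Xᵢ`; the sign of `-h` is that of
    -- integration by parts.
    have h1 := hrep (fun x => φ x • EuclideanSpace.single i 1) ⟨hφ.smul contDiff_const,
      hc.smul_right, fun x => Submodule.smul_mem _ _ (Submodule.subset_span ⟨i, hi, rfl⟩)⟩
    have h2 : (fun x => G.leftField (φ x • EuclideanSpace.single i 1) x) =
        fun x => φ x • G.X i x := by
      ext1 x
      simp only [ExpLieGroup.leftField, ExpLieGroup.X, map_smul]
    rw [h2, hμ, integral_withDensity_ofReal hρ_meas hρ_nonneg,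
      integral_withDensity_ofReal hρ_meas hρ_nonneg] at h1
    rw [setIntegral_univ, setIntegral_univ, h1, ← integral_neg]
    congr 1 with x
    simp only [inner_smul_right, EuclideanSpace.inner_single_right, PiLp.neg_apply]
    simp only [one_mul, conj_trivial]
    ring
  refine ⟨fun Ω _ _ _ => ⟨memLp_one_iff_integrable.2 hρi.restrict, fun i hi =>
    ⟨_, memLp_one_iff_integrable.2 (hgi i).restrict, (hweak i hi).of_univ Ω⟩⟩,
    fun x => G.leftField (G.horizontalPart (-h x)) x, ?_,
    fun x => G.leftField_mem_horizontalSpace (G.horizontalPart_mem _) x,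
    ⟨_, fun i hi => ⟨(hgi i).locallyIntegrable, hweak i hi⟩, Eventually.of_forall fun x => ?_⟩, ?_⟩
  · simp only [G.leftField_horizontalPart]
    exact Finset.measurable_fun_sum _ fun i _ => (hcoord i).smul (G.continuous_X i).measurable
  · simp only [G.leftField_horizontalPart, Finset.smul_sum, smul_smul]
  · refine le_trans (eLpNorm_mono fun x => ?_) hnorm
    rw [G.tangentNorm_leftField, norm_norm]
    exact (G.norm_horizontalPart_le _).trans_eq (norm_neg _)
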